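/- There exists a topological space $X$ with the following properties. 1. $X$ is regular (including the $T_1$ axiom), separable, first-countable and scattered, where scattered means that every nonempty subspace of $X$ has an isolated point. 2. $X$ is homeomorphic to a subspace of a Hausdorff totally countably compact space, where a space is totally countably compact if each of its infinite subsets contains an infinite subset whose closure in the space is compact. 3. $X$ is not homeomorphic to any subspace of a Urysohn countably compact space, where a space is Urysohn if any two distinct points have disjoint closed neighborhoods, and countably compact if each sequence in it has an accumulation point. -/

import Mathlib

/-- A topological space is totally countably compact if every infinite subset contains an
infinite subset whose closure in the space is compact. -/
def IsTotallyCountablyCompactSpace (X : Type*) [TopologicalSpace X] : Prop :=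
  ∀ I : Set X, I.Infinite → ∃ J : Set X, J ⊆ I ∧ J.Infinite ∧ IsCompact (closure J)

/-- A topological space is scattered if every nonempty subset `S` has a point that is isolated
in `S`, that is, a point with an open neighbourhood meeting `S` in this point only. -/
def IsScatteredSpace (X : Type*) [TopologicalSpace X] : Prop :=
  ∀ S : Set X, S.Nonempty → ∃ x ∈ S, ∃ U : Set X, IsOpen U ∧ U ∩ S = {x}

open Set Filter Topology

/-! The space is a ladder built over an unbounded well-ordered scale of functions `f_α`. For each
`n` there are two copies `i` of the grid `ℕ × ℕ`. In both copies the region between the graphs of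
earlier functions and that of `f_α` converges to the same point `rung n α`, while the columns
converge to points `col N k` with `N = n` in one copy and `N = n + 1` in the other. Thus the rungs
of index `n` link the levels `n` and `n + 1`. The levels converge to `top`.

With the points `lim N` and all rungs, every infinite set contains an infinite convergent subset
(`hasConvergentSubset_of_infinite`), and the space is Hausdorff. Deleting every `lim N` and the
rungs at non-successor indices leaves the required `X`; at its points `exists_basis` gives countable
bases that shrink even after closure.

In a Urysohn countably compact space containing `X`, the columns of each level have a cluster point.
By unboundedness of the scale, closed neighbourhoods of the cluster points of consecutive levels
share a rung, so these points coincide (`clusterPt_col_eq_succ`). The common point must be `top`,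
which has a neighbourhood missing all columns of level `0`. -/

/-- An unbounded scale indexed by a linear order: a family of functions `ℕ → ℕ`, strictly increasing
modulo finite sets, starting at `0`, and unbounded on every infinite set of arguments. -/
structure UnboundedScale (B : Type) [LinearOrder B] [OrderBot B] where
  /-- The functions of the scale. -/
  fn : B → ℕ → ℕ
  fn_bot : ∀ k, fn ⊥ k = 0
  eventually_lt : ∀ {α β : B}, α < β → ∀ᶠ k in atTop, fn α k < fn β k
  unbounded : ∀ K : Set ℕ, K.Infinite → ∀ g : ℕ → ℕ, ∃ α, ∃ᶠ k in atTop, k ∈ K ∧ g k < fn α k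

/-! ### Existence of a scale -/

/-- A linear order has a cofinal subset that is well-ordered. -/
theorem exists_isCofinal_wellFoundedLT (α : Type*) [LinearOrder α] :
    ∃ s : Set α, IsCofinal s ∧ WellFoundedLT s := by
  -- Fix an arbitrary well-ordering and keep the elements larger than all their predecessors in it;
  -- on these the two orders agree.
  refine ⟨_, isCofinal_setOfPred_imp_lt (WellOrderingRel (α := α)), ⟨?_⟩⟩
  refine Subrelation.wf (r := InvImage WellOrderingRel Subtype.val) ?_
    (InvImage.wf _ WellOrderingRel.isWellOrder.wf)
  rintro ⟨a, ha⟩ ⟨b, hb⟩ hab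
  have hab : a < b := hab
  rcases trichotomous_of WellOrderingRel a b with h | h | h
  · exact h
  · exact absurd h hab.ne
  · exact absurd (ha b h) hab.not_gt

/-- A function dominating `g` at the next element of the infinite set `K` from each argument on,
as well as the identity, can be chosen monotone. -/
theorem exists_monotone_dominating (K : Set ℕ) (hK : K.Infinite) (g : ℕ → ℕ) :
    ∃ G : ℕ → ℕ, Monotone G ∧ ∀ f : ℕ → ℕ, Monotone f →
      (∀ᶠ k in atTop, k ∈ K → f k ≤ g k) → ∀ᶠ k in atTop, f k < G k := by
  choose next hnext hle using fun k => hK.exists_gt k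
  refine ⟨fun k => ∑ j ∈ Finset.range (k + 1), (g (next j) + 1), ?_, ?_⟩
  · intro a b hab
    exact Finset.sum_le_sum_of_subset (Finset.range_mono (by omega))
  · intro f hf h
    obtain ⟨N, hN⟩ := eventually_atTop.1 h
    refine eventually_atTop.2 ⟨N, fun k hk => ?_⟩
    have h1 : f k ≤ g (next k) := (hf (hle k).le).trans (hN _ (hk.trans (hle k).le) (hnext k))
    have h2 : g (next k) + 1 ≤ ∑ j ∈ Finset.range (k + 1), (g (next j) + 1) :=
      Finset.single_le_sum (f := fun j => g (next j) + 1) (fun _ _ => Nat.zero_le _)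
        (Finset.self_mem_range_succ k)
    exact (Nat.lt_succ_of_le h1).trans_le h2

/-- Every strict order contains a well-ordered chain without a strict upper bound. -/
theorem exists_wellOrdered_unbounded {M : Type} (r : M → M → Prop) (rirr : ∀ f, ¬ r f f)
    (rtrans : ∀ {f g h}, r f g → r g h → r f h) :
    ∃ (B : Type) (_ : LinearOrder B) (_ : WellFoundedLT B) (e : B → M),
      (∀ a b, a < b → r (e a) (e b)) ∧ ∀ g, ∃ b, ¬ r (e b) g := by
  classical
  obtain ⟨c, hc⟩ : ∃ c, IsMaxChain r c := ⟨_, maxChain_spec⟩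
  let rc : c → c → Prop := fun f g => r f g
  have : IsStrictTotalOrder c rc :=
    { irrefl := fun f => rirr f
      trans := fun _ _ _ h1 h2 => rtrans h1 h2
      trichotomous := fun a b h1 h2 => by
        by_contra hne
        rcases hc.1 a.2 b.2 (fun h => hne (Subtype.ext h)) with h | h
        exacts [h1 h, h2 h] }
  let _ : LinearOrder c := linearOrderOfSTO rc
  obtain ⟨s, hs, hwf⟩ := exists_isCofinal_wellFoundedLT c
  refine ⟨s, inferInstance, hwf, fun b => b.1.1, fun a b h => h, fun g => ?_⟩
  by_contra! hb
  have hall : ∀ x ∈ c, r x g := by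
    intro x hx
    obtain ⟨b, hbs, hxb⟩ := hs ⟨x, hx⟩
    rcases hxb.lt_or_eq with h | h
    · exact rtrans (show r x b.1 from h) (hb ⟨b, hbs⟩)
    · subst h
      exact hb ⟨_, hbs⟩
  have hins : IsChain r (insert g c) := hc.1.insert fun x hx _ => Or.inr (hall x hx)
  have hmem : g ∈ c := by
    rw [hc.2 hins (subset_insert _ _)]
    exact mem_insert _ _
  exact rirr _ (hall _ hmem)

/-- Monotone functions are used because for them a bound along one infinite set of arguments yields
a bound everywhere, so a chain unbounded on `ℕ` is unbounded on every infinite set. -/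
theorem UnboundedScale.exists_scale :
    ∃ (B : Type) (_ : LinearOrder B) (_ : OrderBot B), WellFoundedLT B ∧
      Nonempty (UnboundedScale B) := by
  classical
  obtain ⟨B, _, hwf, e, hlt, hunb⟩ := exists_wellOrdered_unbounded
    (M := {f : ℕ → ℕ // Monotone f}) (fun f g => ∀ᶠ k in atTop, f.1 k < g.1 k)
    (fun f h => by
      obtain ⟨k, hk⟩ := h.exists
      exact lt_irrefl _ hk)
    (fun h1 h2 => by filter_upwards [h1, h2] with k a b using a.trans b)
  have key : ∀ K : Set ℕ, K.Infinite → ∀ g : ℕ → ℕ,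
      ∃ α : B, ∃ᶠ k in atTop, k ∈ K ∧ g k < (e α).1 k := by
    intro K hK g
    obtain ⟨G, hG, hdom⟩ := exists_monotone_dominating K hK g
    obtain ⟨b, hb⟩ := hunb ⟨G, hG⟩
    by_contra! hcon
    exact hb (hdom _ (e b).2 (by simpa using hcon b))
  have : Nonempty B := ⟨(key univ infinite_univ 0).choose⟩
  let _ : OrderBot B := WellFoundedLT.toOrderBot B
  refine ⟨B, inferInstance, inferInstance, hwf,
    ⟨⟨fun α k => if α = ⊥ then 0 else (e α).1 k, fun k => if_pos rfl, ?_, ?_⟩⟩⟩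
  · intro α β h
    have hβ : β ≠ ⊥ := (bot_le.trans_lt h).ne'
    filter_upwards [hlt _ _ h] with k hk
    simp only [if_neg hβ]
    split_ifs
    · exact (Nat.zero_le _).trans_lt hk
    · exact hk
  · intro K hK g
    -- The maximum excludes `⊥`, whose function has been replaced by `0`.
    obtain ⟨α, hα⟩ := key K hK fun k => max (g k) ((e ⊥).1 k)
    have hne : α ≠ ⊥ := by
      rintro rfl
      obtain ⟨k, -, hk⟩ := hα.exists
      exact absurd hk (not_lt.2 (le_max_right _ _))
    refine ⟨α, hα.mono fun k hk => ⟨hk.1, ?_⟩⟩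
    simp only [if_neg hne]
    exact (le_max_left _ _).trans_lt hk.2

/-! ### Order properties of the index set -/

namespace UnboundedScale

variable {B : Type} [LinearOrder B] [OrderBot B]

theorem eventually_le (s : UnboundedScale B) {α β : B} (h : α ≤ β) : ∀ᶠ k in atTop, s.fn α k ≤ s.fn β k := by
  rcases h.eq_or_lt with rfl | h
  · simp
  · exact (s.eventually_lt h).mono fun _ => le_of_lt

theorem lt_of_frequently (s : UnboundedScale B) {α β : B} {g : ℕ → ℕ} (h : ∃ᶠ k in atTop, g k < s.fn β k)
    (hg : ∀ᶠ k in atTop, s.fn α k ≤ g k) : α < β := by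
  by_contra hle
  obtain ⟨k, h1, h2, h3⟩ := (h.and_eventually (hg.and (s.eventually_le (not_lt.1 hle)))).exists
  omega

theorem exists_gt_seq (s : UnboundedScale B) (u : ℕ → B) : ∃ β, ∀ i, u i < β := by
  -- The diagonal sum eventually dominates every `s.fn (u i)`, so a function not bounded by it has
  -- an index above all `u i`.
  obtain ⟨β, hβ⟩ := s.unbounded univ infinite_univ
    fun k => ∑ i ∈ Finset.range (k + 1), s.fn (u i) k
  refine ⟨β, fun i => s.lt_of_frequently (hβ.mono fun _ => And.right) ?_⟩
  filter_upwards [eventually_ge_atTop i] with k hk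
  exact Finset.single_le_sum (f := fun i => s.fn (u i) k) (fun _ _ => Nat.zero_le _)
    (Finset.mem_range.2 (by omega))

theorem exists_covBy (s : UnboundedScale B) [WellFoundedLT B] (α : B) : ∃ β, α ⋖ β := by
  obtain ⟨β, hβ⟩ := s.exists_gt_seq fun _ => α
  obtain ⟨b, hb, hmin⟩ := wellFounded_lt.has_min {β | α < β} ⟨β, hβ 0⟩
  exact ⟨b, hb, fun c h1 h2 => hmin c h1 h2⟩

/-- Every infinite subset of the index set accumulates from below at some index. -/
theorem exists_accumulation_below (s : UnboundedScale B) [WellFoundedLT B] {S : Set B} (hS : S.Infinite) :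
    ∃ α, (S ∩ Iio α).Infinite ∧ ∀ γ < α, (S ∩ Iic γ).Finite := by
  obtain ⟨β, hβ⟩ := s.exists_gt_seq fun i => (hS.natEmbedding S i : B)
  have hne : (S ∩ Iio β).Infinite :=
    (infinite_range_of_injective
      (Subtype.val_injective.comp (hS.natEmbedding S).injective)).mono
      (range_subset_iff.2 fun i => ⟨(hS.natEmbedding S i).2, hβ i⟩)
  obtain ⟨α, hα, hmin⟩ := wellFounded_lt.has_min {β | (S ∩ Iio β).Infinite} ⟨β, hne⟩
  refine ⟨α, hα, fun γ hγ => ((not_infinite.1 fun h => hmin γ h hγ).union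
    (finite_singleton γ)).subset ?_⟩
  rintro x ⟨hx, hxγ⟩
  rcases (show x ≤ γ from hxγ).lt_or_eq with h | h
  · exact Or.inl ⟨hx, h⟩
  · exact Or.inr h

end UnboundedScale

/-! ### The space and its topology -/

/-- The points of the scale space: isolated points `dot n k m i`, limits `col N k` of the columns
`dot n k · i` with `n + i.toNat = N`, points `rung n α` that are limits of the regions between the
graphs of the functions of the scale, limits `lim N` of the sequences `col N ·`, and a point `top`
to which the levels converge. -/
inductive ScalePoint {B : Type} [LinearOrder B] [OrderBot B] (s : UnboundedScale B) : Type
  | dot (n k m : ℕ) (i : Bool)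
  | col (N k : ℕ)
  | rung (n : ℕ) (α : B)
  | lim (N : ℕ)
  | top

namespace ScalePoint

variable {B : Type} [LinearOrder B] [OrderBot B] {s : UnboundedScale B}

/-- The level of a point. -/
def level : ScalePoint s → ℕ
  | dot n _ _ i => n + i.toNat
  | col N _ => N
  | rung n _ => n
  | lim N => N
  | top => 0

/-- Dots and the points `rung n ⊥` are isolated. The rung clause is stable under intersection
because raising `γ` shrinks the region, up to finitely many columns. -/
instance : TopologicalSpace (ScalePoint s) where
  IsOpen U :=
    (∀ N k, col N k ∈ U → ∀ᶠ m in atTop, ∀ n i, n + i.toNat = N → dot n k m i ∈ U) ∧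
    (∀ n α, ⊥ < α → rung n α ∈ U → ∃ γ < α, (∀ β, γ < β → β ≤ α → rung n β ∈ U) ∧
      ∀ᶠ k in atTop, ∀ m i, s.fn γ k ≤ m → m < s.fn α k → dot n k m i ∈ U) ∧
    (∀ N, lim N ∈ U → ∀ᶠ k in atTop, col N k ∈ U) ∧
    (top ∈ U → ∃ N, ∀ x : ScalePoint s, N ≤ x.level → x ∈ U)
  isOpen_univ := ⟨by simp, fun n α h _ => ⟨⊥, h, by simp⟩, by simp, by simp⟩
  isOpen_inter := by
    rintro U V ⟨hU1, hU2, hU3, hU4⟩ ⟨hV1, hV2, hV3, hV4⟩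
    refine ⟨fun N k h => ?_, fun n α hα h => ?_, fun N h => ?_, fun h => ?_⟩
    · filter_upwards [hU1 N k h.1, hV1 N k h.2] with m h1 h2 n i hi using ⟨h1 n i hi, h2 n i hi⟩
    · obtain ⟨γ, hγ, h1, h2⟩ := hU2 n α hα h.1
      obtain ⟨δ, hδ, h3, h4⟩ := hV2 n α hα h.2
      refine ⟨max γ δ, max_lt hγ hδ, fun β hβ hβα => ⟨h1 β ((le_max_left _ _).trans_lt hβ) hβα,
        h3 β ((le_max_right _ _).trans_lt hβ) hβα⟩, ?_⟩
      filter_upwards [h2, h4, s.eventually_le (le_max_left γ δ),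
        s.eventually_le (le_max_right γ δ)] with k a b c d m i hm hm'
      exact ⟨a m i (c.trans hm) hm', b m i (d.trans hm) hm'⟩
    · filter_upwards [hU3 N h.1, hV3 N h.2] with k h1 h2 using ⟨h1, h2⟩
    · obtain ⟨N, hN⟩ := hU4 h.1
      obtain ⟨M, hM⟩ := hV4 h.2
      exact ⟨max N M, fun x hx =>
        ⟨hN x ((le_max_left _ _).trans hx), hM x ((le_max_right _ _).trans hx)⟩⟩
  isOpen_sUnion := by
    intro S hS
    refine ⟨?_, ?_, ?_, ?_⟩
    · rintro N k ⟨U, hU, h⟩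
      filter_upwards [(hS U hU).1 N k h] with m hm n i hi using ⟨U, hU, hm n i hi⟩
    · rintro n α hα ⟨U, hU, h⟩
      obtain ⟨γ, hγ, h1, h2⟩ := (hS U hU).2.1 n α hα h
      refine ⟨γ, hγ, fun β hβ hβα => ⟨U, hU, h1 β hβ hβα⟩, ?_⟩
      filter_upwards [h2] with k hk m i hm hm' using ⟨U, hU, hk m i hm hm'⟩
    · rintro N ⟨U, hU, h⟩
      filter_upwards [(hS U hU).2.2.1 N h] with k hk using ⟨U, hU, hk⟩
    · rintro ⟨U, hU, h⟩
      obtain ⟨N, hN⟩ := (hS U hU).2.2.2 h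
      exact ⟨N, fun x hx => ⟨U, hU, hN x hx⟩⟩

theorem isOpen_iff {U : Set (ScalePoint s)} : IsOpen U ↔
    (∀ N k, col N k ∈ U → ∀ᶠ m in atTop, ∀ n i, n + i.toNat = N → dot n k m i ∈ U) ∧
    (∀ n α, ⊥ < α → rung n α ∈ U → ∃ γ < α, (∀ β, γ < β → β ≤ α → rung n β ∈ U) ∧
      ∀ᶠ k in atTop, ∀ m i, s.fn γ k ≤ m → m < s.fn α k → dot n k m i ∈ U) ∧
    (∀ N, lim N ∈ U → ∀ᶠ k in atTop, col N k ∈ U) ∧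
    (top ∈ U → ∃ N, ∀ x : ScalePoint s, N ≤ x.level → x ∈ U) := Iff.rfl

/-! ### Clopen sets -/

theorem isClopen_dot (n k m : ℕ) (i : Bool) : IsClopen {(dot n k m i : ScalePoint s)} := by
  refine ⟨⟨isOpen_iff.2 ⟨fun N k' _ => ?_, fun n' α hα _ => ⟨⊥, hα, by simp, ?_⟩, by simp,
    fun _ => ⟨n + i.toNat + 1, ?_⟩⟩⟩, isOpen_iff.2 (by simp)⟩
  · filter_upwards [eventually_gt_atTop m] with m' hm' n i _ h
    injection h
    omega
  · filter_upwards [eventually_gt_atTop k] with k' hk' m i _ _ h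
    injection h
    omega
  · rintro x hx rfl
    simp [level] at hx

/-- The column below `col N k`, from height `m₀` on. -/
def column (N k m₀ : ℕ) : Set (ScalePoint s) :=
  {x | x = col N k ∨ ∃ n i m, n + i.toNat = N ∧ m₀ ≤ m ∧ x = dot n k m i}

theorem isClopen_column (N k m₀ : ℕ) : IsClopen (column N k m₀ : Set (ScalePoint s)) := by
  refine ⟨⟨isOpen_iff.2 ⟨fun N' k' h => ?_, fun n' α hα _ => ⟨⊥, hα, by simp [column], ?_⟩, ?_,
    fun _ => ⟨N + 1, ?_⟩⟩⟩, isOpen_iff.2 ⟨fun N' k' h => ?_, ?_, ?_, ?_⟩⟩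
  · refine Eventually.of_forall fun m n i hN => ?_
    rintro (h' | ⟨n', i', m', h1, h2, h3⟩)
    · cases h'
    · cases h3
      exact h (Or.inl (by rw [← hN, ← h1]))
  · filter_upwards [eventually_gt_atTop k] with k' hk' m i _ _
    simp only [column, mem_compl_iff, mem_ofPred_eq, reduceCtorEq, dot.injEq, false_or]
    rintro ⟨_, _, _, _, _, _, h, _⟩
    omega
  · intro N' _
    filter_upwards [eventually_gt_atTop k] with k' hk'
    simp only [column, mem_compl_iff, mem_ofPred_eq, reduceCtorEq, col.injEq]
    rintro (h | ⟨_, _, _, _, _, h⟩)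
    · omega
    · exact h
  · rintro x hx (rfl | ⟨n, i, m, h, -, rfl⟩) <;> simp [level] at hx <;> omega
  · rcases h with h | ⟨_, _, _, _, _, h⟩
    · cases h
      filter_upwards [eventually_ge_atTop m₀] with m hm n i hi using Or.inr ⟨n, i, m, hi, hm, rfl⟩
    · cases h
  all_goals simp [column]

/-- The set of the points `rung n β` with `γ < β ≤ α` and of the points `dot n k m i` with `k₀ ≤ k`
between the graphs of `γ` and `α`. -/
def region (n : ℕ) (γ α : B) (k₀ : ℕ) : Set (ScalePoint s) :=
  {x | (∃ β, γ < β ∧ β ≤ α ∧ x = rung n β) ∨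
    ∃ k m i, k₀ ≤ k ∧ s.fn γ k ≤ m ∧ m < s.fn α k ∧ x = dot n k m i}

theorem isClopen_region (n : ℕ) (γ α : B) (k₀ : ℕ) :
    IsClopen (region n γ α k₀ : Set (ScalePoint s)) := by
  refine ⟨⟨isOpen_iff.2 ⟨fun N k _ => ?_, fun n' β hβ h => ?_, by simp [region],
    -- Dots of the region have level `n` or `n + 1`, so levels from `n + 2` on miss it.
    fun _ => ⟨n + 2, ?_⟩⟩⟩, isOpen_iff.2 ⟨by simp [region], fun n' β hβ h => ?_,
      by simp [region], by simp [region]⟩⟩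
  · filter_upwards [eventually_ge_atTop (s.fn α k)] with m hm n i _
    rintro (⟨_, _, _, h⟩ | ⟨_, _, _, _, _, h, h'⟩)
    · cases h
    · cases h'
      omega
  · by_cases hn : n' = n
    · subst hn
      rcases le_or_gt β γ with hβγ | hβγ
      · refine ⟨⊥, hβ, ?_, ?_⟩
        · rintro δ hδ hδβ (⟨_, h1, h2, h3⟩ | ⟨_, _, _, _, _, _, h3⟩)
          · cases h3
            exact absurd h1 (not_lt.2 (hδβ.trans hβγ))
          · cases h3
        · filter_upwards [s.eventually_le hβγ] with k hk m i hm hm'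
          rintro (⟨_, _, _, h3⟩ | ⟨_, _, _, _, h2, _, h3⟩)
          · cases h3
          · cases h3
            omega
      · have hαβ : α < β := not_le.1 fun hle => h (Or.inl ⟨β, hβγ, hle, rfl⟩)
        refine ⟨α, hαβ, ?_, ?_⟩
        · rintro δ hδ hδβ (⟨_, h1, h2, h3⟩ | ⟨_, _, _, _, _, _, h3⟩)
          · cases h3
            exact absurd hδ (not_lt.2 h2)
          · cases h3
        · refine Eventually.of_forall fun k m i hm hm' => ?_
          rintro (⟨_, _, _, h3⟩ | ⟨_, _, _, _, h2, h3, h4⟩)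
          · cases h3
          · cases h4
            omega
    · refine ⟨⊥, hβ, ?_, Eventually.of_forall fun k m i hm hm' => ?_⟩
      · rintro δ hδ hδβ (⟨_, h1, h2, h3⟩ | ⟨_, _, _, _, _, _, h3⟩)
        · cases h3
          exact hn rfl
        · cases h3
      · rintro (⟨_, _, _, h3⟩ | ⟨_, _, _, _, _, _, h3⟩)
        · cases h3
        · cases h3
          exact hn rfl
  · rintro x hx (⟨_, _, _, rfl⟩ | ⟨_, _, i, _, _, _, rfl⟩)
    · simp [level] at hx
    · cases i <;> simp [level] at hx
  · rcases h with ⟨δ, h1, h2, h3⟩ | ⟨_, _, _, _, _, _, h3⟩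
    · cases h3
      refine ⟨γ, h1, fun δ hδ hδβ => Or.inl ⟨δ, hδ, hδβ.trans h2, rfl⟩, ?_⟩
      filter_upwards [s.eventually_le h2, eventually_ge_atTop k₀] with k hk hk0 m i hm hm'
      exact Or.inr ⟨k, m, i, hk0, hm, hm'.trans_le hk, rfl⟩
    · cases h3

/-! ### Neighbourhoods of the top point -/

/-- The points of level at least `N`, with the top point. -/
def upper (N : ℕ) : Set (ScalePoint s) := {x | x = top ∨ N ≤ x.level}

theorem isOpen_upper (N : ℕ) : IsOpen (upper N : Set (ScalePoint s)) := by
  refine isOpen_iff.2 ⟨fun N' k h => ?_, fun n α hα h => ⟨⊥, hα, fun β _ _ => ?_, ?_⟩,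
    fun N' h => ?_, fun _ => ⟨N, fun x hx => Or.inr hx⟩⟩
  · refine Eventually.of_forall fun m n i hi => ?_
    simp [upper, level] at h ⊢
    omega
  · simp [upper, level] at h ⊢
    omega
  · refine Eventually.of_forall fun m n i hi => ?_
    simp [upper, level] at h ⊢
    omega
  · refine Eventually.of_forall fun k => ?_
    simp [upper, level] at h ⊢
    omega

/-- The only new limits are the rungs of index `N`: they have level `N` but are approached by dots
with `i = true`, of level `N + 1`. -/
theorem closure_upper_subset (N : ℕ) :
    closure (upper (N + 1) : Set (ScalePoint s)) ⊆ upper N := by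
  have hcl : IsClosed (upper (N + 1) ∪ range (rung N) : Set (ScalePoint s)) := by
    refine ⟨isOpen_iff.2 ⟨fun N' k h => ?_, fun n α hα h => ⟨⊥, hα, fun β _ _ => ?_, ?_⟩,
      fun N' h => ?_, fun h => absurd (Or.inl (Or.inl rfl)) h⟩⟩
    · refine Eventually.of_forall fun m n i hi => ?_
      simp [upper, level] at h ⊢
      omega
    · simp [upper, level] at h ⊢
      refine ⟨h.1, h.2 ∘ ?_⟩
      rintro ⟨_, rfl⟩
      simp
    · refine Eventually.of_forall fun k m i _ _ => ?_
      have : n ≠ N := fun e => h (Or.inr ⟨α, by rw [e]⟩)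
      simp [upper, level] at h ⊢
      cases i <;> simp <;> omega
    · refine Eventually.of_forall fun k => ?_
      simp [upper, level] at h ⊢
      omega
  refine (closure_minimal subset_union_left hcl).trans ?_
  rintro x ((rfl | h) | ⟨α, rfl⟩)
  · exact Or.inl rfl
  · exact Or.inr ((Nat.le_succ N).trans h)
  · exact Or.inr le_rfl

/-! ### Separation -/

/-- The points of level `N` other than rungs. -/
def stratum (N : ℕ) : Set (ScalePoint s) :=
  {x | x ≠ top ∧ (∀ n α, x ≠ rung n α) ∧ x.level = N}

theorem isOpen_stratum (N : ℕ) : IsOpen (stratum N : Set (ScalePoint s)) := by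
  refine isOpen_iff.2 ⟨fun N' k h => ?_, ?_, fun N' h => ?_, ?_⟩
  · refine Eventually.of_forall fun m n i hi => ?_
    simp [stratum, level] at h ⊢
    omega
  · simp [stratum]
  · refine Eventually.of_forall fun k => ?_
    simp [stratum, level] at h ⊢
    omega
  · simp [stratum]

theorem lim_mem_stratum (N : ℕ) : (lim N : ScalePoint s) ∈ stratum N := by
  simp [stratum, level]

theorem disjoint_stratum_upper (N : ℕ) :
    Disjoint (stratum N : Set (ScalePoint s)) (upper (N + 1)) :=
  disjoint_left.2 fun _ hx hx' => hx'.elim hx.1 fun h => by rw [hx.2.2] at h; omega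

theorem separated_of_isClopen {X : Type*} [TopologicalSpace X] {U : Set X} (hU : IsClopen U)
    {x y : X} (hx : x ∈ U) (hy : y ∉ U) : SeparatedNhds {x} {y} :=
  ⟨U, Uᶜ, hU.2, hU.1.isOpen_compl, singleton_subset_iff.2 hx, singleton_subset_iff.2 hy,
    disjoint_compl_right⟩

theorem isClopen_rung_bot (n : ℕ) : IsClopen {(rung n ⊥ : ScalePoint s)} := by
  refine ⟨⟨isOpen_iff.2 ⟨by simp, fun n' α hα _ => ⟨⊥, hα, fun β hβ _ h => ?_, by simp⟩, by simp,
    fun _ => ⟨n + 1, ?_⟩⟩⟩, isOpen_iff.2 ⟨by simp, fun n' α hα h => ?_, by simp, by simp⟩⟩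
  · injection h with _ h
    exact hβ.ne' h
  · rintro x hx rfl
    simp [level] at hx
  · injection h with _ h
    exact absurd h hα.ne'

theorem rung_mem_region {n n' k₀ : ℕ} {α β γ : B} :
    (rung n' β : ScalePoint s) ∈ region n γ α k₀ ↔ n' = n ∧ γ < β ∧ β ≤ α := by
  simp only [region, mem_ofPred_eq, rung.injEq, reduceCtorEq, and_false, exists_false, or_false]
  grind

theorem separated_rung {n : ℕ} {α : B} {y : ScalePoint s} (h : rung n α ≠ y)
    (hy : ∀ n k m i, y ≠ dot n k m i) : SeparatedNhds {rung n α} {y} := by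
  rcases (bot_le (a := α)).eq_or_lt with rfl | hα
  · exact separated_of_isClopen (isClopen_rung_bot n) rfl fun h' => h h'.symm
  · by_cases hmem : y ∈ region n ⊥ α 0
    · obtain ⟨β, h1, h2, rfl⟩ | ⟨_, _, _, _, _, _, rfl⟩ := hmem
      -- Two rungs of the same index are separated by the region ending at the smaller one.
      · refine (separated_of_isClopen (isClopen_region n ⊥ β 0) (rung_mem_region.2 ⟨rfl, h1, le_rfl⟩)
          fun h' => ?_).symm
        exact h (by rw [le_antisymm (rung_mem_region.1 h').2.2 h2])
      · exact absurd rfl (hy _ _ _ _)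
    · exact separated_of_isClopen (isClopen_region n ⊥ α 0)
        (rung_mem_region.2 ⟨rfl, hα, le_rfl⟩) hmem

theorem separated_col {N k : ℕ} {y : ScalePoint s} (h : col N k ≠ y)
    (hy : ∀ n k m i, y ≠ dot n k m i) : SeparatedNhds {col N k} {y} := by
  refine separated_of_isClopen (isClopen_column N k 0) (Or.inl rfl) ?_
  rintro (rfl | ⟨_, _, _, _, _, rfl⟩)
  · exact h rfl
  · exact hy _ _ _ _ rfl

theorem separated_dot {n k m : ℕ} {i : Bool} {y : ScalePoint s} (h : dot n k m i ≠ y) :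
    SeparatedNhds {dot n k m i} {y} :=
  separated_of_isClopen (isClopen_dot n k m i) rfl fun h' => h h'.symm

theorem separated_lim_top (N : ℕ) : SeparatedNhds {(lim N : ScalePoint s)} {top} :=
  ⟨stratum N, upper (N + 1), isOpen_stratum N, isOpen_upper _,
    singleton_subset_iff.2 (lim_mem_stratum N), singleton_subset_iff.2 (Or.inl rfl),
    disjoint_stratum_upper N⟩

theorem separated_lim_lim {N M : ℕ} (h : N ≠ M) :
    SeparatedNhds {(lim N : ScalePoint s)} {lim M} :=
  ⟨stratum N, stratum M, isOpen_stratum N, isOpen_stratum M,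
    singleton_subset_iff.2 (lim_mem_stratum N), singleton_subset_iff.2 (lim_mem_stratum M),
    disjoint_left.2 fun _ h1 h2 => h (h1.2.2.symm.trans h2.2.2)⟩

instance : T2Space (ScalePoint s) := by
  refine t2Space_iff_disjoint_nhds.2 fun x y h => ?_
  suffices SeparatedNhds {x} {y} by simpa [separatedNhds_iff_disjoint] using this
  rcases x with ⟨n, k, m, i⟩ | ⟨N, k⟩ | ⟨n, α⟩ | N | _
  · exact separated_dot h
  all_goals rcases y with ⟨n', k', m', i'⟩ | ⟨N', k'⟩ | ⟨n', α'⟩ | N' | _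
  all_goals first
    | exact (separated_dot h.symm).symm
    | exact separated_col h (by simp)
    | exact (separated_col h.symm (by simp)).symm
    | exact separated_rung h (by simp)
    | exact (separated_rung h.symm (by simp)).symm
    | exact separated_lim_top _
    | exact (separated_lim_top _).symm
    | exact separated_lim_lim fun e => h (by rw [e])
    | exact absurd rfl h

/-! ### Total countable compactness -/

/-- `J` converges to `x`, so `insert x J` is compact, hence closed. -/
theorem isCompact_closure_of_forall_finite_diff {X : Type*} [TopologicalSpace X] [T2Space X]
    {J : Set X} {x : X} (h : ∀ U, IsOpen U → x ∈ U → (J \ U).Finite) : IsCompact (closure J) := by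
  have ht : Tendsto (Subtype.val : J → X) cofinite (𝓝 x) := by
    refine (nhds_basis_opens x).tendsto_right_iff.2 fun U hU => ?_
    refine ((h U hU.2 hU.1).preimage Subtype.val_injective.injOn).subset ?_
    intro y hy
    exact ⟨y.2, hy⟩
  have hc := ht.isCompact_insert_range_of_cofinite
  rw [Subtype.range_coe] at hc
  exact hc.of_isClosed_subset isClosed_closure
    (closure_minimal (subset_insert _ _) hc.isClosed)

/-- The set `I` contains an infinite subset converging to some point. -/
def HasConvergentSubset {X : Type*} [TopologicalSpace X] (I : Set X) : Prop :=
  ∃ J ⊆ I, J.Infinite ∧ ∃ x, ∀ U, IsOpen U → x ∈ U → (J \ U).Finite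

theorem HasConvergentSubset.image {X ι : Type*} [TopologicalSpace X] {I : Set X} {e : ι → X}
    (he : Function.Injective e) {S : Set ι} (hS : S.Infinite) (hSI : ∀ a ∈ S, e a ∈ I) (x : X)
    (h : ∀ U, IsOpen U → x ∈ U → {a ∈ S | e a ∉ U}.Finite) : HasConvergentSubset I := by
  refine ⟨e '' S, image_subset_iff.2 hSI, hS.image he.injOn, x, fun U hU hx => ?_⟩
  refine ((h U hU hx).image e).subset ?_
  rintro _ ⟨⟨a, ha, rfl⟩, haU⟩
  exact ⟨a, ⟨ha, haU⟩, rfl⟩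

theorem finite_of_eventually {S : Set ℕ} {p : ℕ → Prop} (h : ∀ᶠ k in atTop, p k) :
    {k ∈ S | ¬ p k}.Finite := by
  rw [← Nat.cofinite_eq_atTop] at h
  exact h.subset fun _ hk => hk.2

theorem hasConvergentSubset_col {I : Set (ScalePoint s)} {N : ℕ}
    (h : {k | col N k ∈ I}.Infinite) : HasConvergentSubset I :=
  .image (e := col N) (fun _ _ h => (col.inj h).2) h (fun _ => id) (lim N) fun _ hU hx =>
    finite_of_eventually (hU.2.2.1 N hx)

theorem hasConvergentSubset_rung [WellFoundedLT B] {I : Set (ScalePoint s)} {n : ℕ}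
    (h : {α | rung n α ∈ I}.Infinite) : HasConvergentSubset I := by
  obtain ⟨α, hα, hfin⟩ := s.exists_accumulation_below h
  refine .image (e := rung n) (fun _ _ h => (rung.inj h).2) hα (fun _ => And.left) (rung n α)
    fun U hU hx => ?_
  obtain ⟨β, -, hβ⟩ := hα.nonempty
  obtain ⟨γ, hγ, h1, -⟩ := hU.2.1 n α (bot_le.trans_lt hβ) hx
  refine (hfin γ hγ).subset ?_
  rintro δ ⟨⟨hδ, hδα⟩, hδU⟩
  exact ⟨hδ, not_lt.1 fun hlt => hδU (h1 δ hlt (le_of_lt hδα))⟩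

theorem hasConvergentSubset_dot [WellFoundedLT B] {I : Set (ScalePoint s)} {n : ℕ} {i : Bool}
    (h : {a : ℕ × ℕ | dot n a.1 a.2 i ∈ I}.Infinite) : HasConvergentSubset I := by
  by_cases hcol : ∃ k, {m | dot n k m i ∈ I}.Infinite
  · obtain ⟨k, hk⟩ := hcol
    exact .image (e := fun m => dot n k m i) (fun _ _ h => (dot.inj h).2.2.1) hk (fun _ => id)
      (col (n + i.toNat) k) fun _ hU hx =>
        finite_of_eventually ((hU.1 _ k hx).mono fun m hm => hm n i rfl)
  · simp only [not_exists, not_infinite] at hcol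
    set S := {a : ℕ × ℕ | dot n a.1 a.2 i ∈ I}
    have hfib : ∀ T ⊆ S, ∀ p : ℕ → Prop, (∀ᶠ k in atTop, p k) → {a ∈ T | ¬ p a.1}.Finite := by
      intro T hT p hp
      have hf : {k | ¬ p k}.Finite := by
        rw [← Nat.cofinite_eq_atTop] at hp
        exact hp
      refine (hf.biUnion fun k _ => (hcol k).image (Prod.mk k)).subset ?_
      rintro ⟨k, m⟩ ⟨hkm, hk⟩
      exact mem_biUnion hk ⟨m, hT hkm, rfl⟩
    -- With finite columns, `S` meets infinitely many of them. Choose one height in each and apply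
    -- unboundedness on this set of columns.
    have hex : ∃ α, {a ∈ S | a.2 < s.fn α a.1}.Infinite := by
      have hproj : (Prod.fst '' S).Infinite := fun hf => h <|
        (hf.biUnion fun k _ => (hcol k).image (Prod.mk k)).subset fun a ha =>
          mem_biUnion (mem_image_of_mem _ ha) ⟨a.2, ha, rfl⟩
      have hg : ∀ k, ∃ m, k ∈ Prod.fst '' S → (k, m) ∈ S := fun k => by
        by_cases hk : k ∈ Prod.fst '' S
        · obtain ⟨⟨_, m⟩, hm, rfl⟩ := hk
          exact ⟨m, fun _ => hm⟩
        · exact ⟨0, fun h => absurd h hk⟩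
      choose g hg using hg
      obtain ⟨α, hα⟩ := s.unbounded _ hproj g
      refine ⟨α, ((Nat.frequently_atTop_iff_infinite.1 hα).image
        (f := fun k => (k, g k)) fun _ _ _ _ h => (Prod.mk.inj h).1).mono ?_⟩
      rintro _ ⟨k, ⟨hk, hkα⟩, rfl⟩
      exact ⟨hg k hk, hkα⟩
    -- For the least such `α`, only finitely many points of `S` lie below any earlier graph, so
    -- those below the graph of `α` converge to `rung n α`.
    obtain ⟨α, hα, hmin⟩ := wellFounded_lt.has_min {α | {a ∈ S | a.2 < s.fn α a.1}.Infinite} hex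
    have hbot : ⊥ < α := by
      refine bot_lt_iff_ne_bot.2 ?_
      rintro rfl
      obtain ⟨a, -, ha⟩ := hα.nonempty
      rw [s.fn_bot] at ha
      omega
    refine .image (e := fun a : ℕ × ℕ => dot n a.1 a.2 i)
      (fun a b h => Prod.ext (dot.inj h).2.1 (dot.inj h).2.2.1) hα (fun _ => And.left) (rung n α)
      fun U hU hx => ?_
    obtain ⟨γ, hγ, -, h2⟩ := hU.2.1 n α hbot hx
    refine ((not_infinite.1 fun h => hmin γ h hγ).union
      (hfib S subset_rfl _ h2)).subset ?_
    rintro ⟨k, m⟩ ⟨⟨ha, haα⟩, haU⟩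
    by_cases hlt : m < s.fn γ k
    · exact Or.inl ⟨ha, hlt⟩
    · exact Or.inr ⟨ha, fun hp => haU (hp m i (not_lt.1 hlt) haα)⟩

theorem hasConvergentSubset_of_infinite [WellFoundedLT B] {I : Set (ScalePoint s)}
    (hI : I.Infinite) : HasConvergentSubset I := by
  by_contra hcon
  have hdot : ∀ n i, {a : ℕ × ℕ | dot n a.1 a.2 i ∈ I}.Finite := fun n i =>
    not_infinite.1 fun h => hcon (hasConvergentSubset_dot h)
  have hcol : ∀ N, {k | col N k ∈ I}.Finite := fun N =>
    not_infinite.1 fun h => hcon (hasConvergentSubset_col h)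
  have hrung : ∀ n, {α | rung n α ∈ I}.Finite := fun n =>
    not_infinite.1 fun h => hcon (hasConvergentSubset_rung h)
  -- Otherwise each level meets `I` in a finite set, and `I` itself converges to `top`.
  refine hcon ⟨I, subset_rfl, hI, top, fun U hU hx => ?_⟩
  obtain ⟨N, hN⟩ := hU.2.2.2 hx
  refine ((((finite_Iic N).biUnion fun n _ => finite_univ.biUnion fun i (_ : i ∈ univ) =>
      (hdot n i).image fun a => dot n a.1 a.2 i).union
    ((finite_Iic N).biUnion fun n _ => (hcol n).image (col n))).union
    (((finite_Iic N).biUnion fun n _ => (hrung n).image (rung n)).union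
      ((finite_Iic N).image lim))).subset ?_
  rintro x ⟨hxI, hxU⟩
  have hlev : x ≠ top → x.level ≤ N := fun _ => le_of_lt (not_le.1 fun h => hxU (hN x h))
  rcases x with ⟨n, k, m, i⟩ | ⟨M, k⟩ | ⟨n, α⟩ | M | _
  · have := hlev (by simp)
    simp only [level] at this
    exact Or.inl (Or.inl (mem_biUnion (show n ≤ N by omega)
      (mem_biUnion (mem_univ i) ⟨(k, m), hxI, rfl⟩)))
  · exact Or.inl (Or.inr (mem_biUnion (hlev (by simp)) ⟨k, hxI, rfl⟩))
  · exact Or.inr (Or.inl (mem_biUnion (hlev (by simp)) ⟨α, hxI, rfl⟩))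
  · exact Or.inr (Or.inr ⟨M, hlev (by simp), rfl⟩)
  · exact absurd hx hxU

theorem isTotallyCountablyCompactSpace [WellFoundedLT B] :
    IsTotallyCountablyCompactSpace (ScalePoint s) := fun _ hI =>
  let ⟨J, hJI, hJ, _, hx⟩ := hasConvergentSubset_of_infinite hI
  ⟨J, hJI, hJ, isCompact_closure_of_forall_finite_diff hx⟩

/-! ### The subspace of points with a countable base of closed neighbourhoods -/

/-- All points except the limits of levels and the rungs that are not indexed by successors. -/
def IsRegularPoint : ScalePoint s → Prop
  | rung _ α => ∃ γ, γ ⋖ α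
  | lim _ => False
  | _ => True

theorem IsRegularPoint.exists_basis {x : ScalePoint s} (hx : x.IsRegularPoint) :
    ∃ V : ℕ → Set (ScalePoint s), (∀ j, IsOpen (V j) ∧ x ∈ V j) ∧
      ∀ U, IsOpen U → x ∈ U → ∃ j, closure (V j) ⊆ U := by
  rcases x with ⟨n, k, m, i⟩ | ⟨N, k⟩ | ⟨n, α⟩ | N | _
  · refine ⟨fun _ => {dot n k m i}, fun _ => ⟨(isClopen_dot n k m i).2, rfl⟩, fun U _ h => ⟨0, ?_⟩⟩
    rw [(isClopen_dot n k m i).1.closure_eq]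
    exact singleton_subset_iff.2 h
  · refine ⟨column N k, fun j => ⟨(isClopen_column N k j).2, Or.inl rfl⟩, fun U hU h => ?_⟩
    obtain ⟨j, hj⟩ := eventually_atTop.1 (hU.1 N k h)
    refine ⟨j, ?_⟩
    rw [(isClopen_column N k j).1.closure_eq]
    rintro x (rfl | ⟨n, i, m, h1, h2, rfl⟩)
    exacts [h, hj m h2 n i h1]
  · obtain ⟨γ, hγ⟩ := hx
    refine ⟨region n γ α, fun j => ⟨(isClopen_region n γ α j).2,
      rung_mem_region.2 ⟨rfl, hγ.1, le_rfl⟩⟩, fun U hU h => ?_⟩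
    obtain ⟨δ, hδ, h1, h2⟩ := hU.2.1 n α (bot_le.trans_lt hγ.1) h
    -- At a successor the lower bound `γ` is the best possible, so only the starting column varies
    -- and the base is countable.
    have hδγ : δ ≤ γ := not_lt.1 fun h => hγ.2 h hδ
    obtain ⟨j, hj⟩ := eventually_atTop.1 (h2.and (s.eventually_le hδγ))
    refine ⟨j, ?_⟩
    rw [(isClopen_region n γ α j).1.closure_eq]
    rintro x (⟨β, h3, h4, rfl⟩ | ⟨k, m, i, h3, h4, h5, rfl⟩)
    · exact h1 β (hδγ.trans_lt h3) h4
    · exact (hj k h3).1 m i ((hj k h3).2.trans h4) h5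
  · exact hx.elim
  · refine ⟨fun j => upper (j + 1), fun j => ⟨isOpen_upper _, Or.inl rfl⟩, fun U hU h => ?_⟩
    obtain ⟨N, hN⟩ := hU.2.2.2 h
    refine ⟨N, (closure_upper_subset N).trans ?_⟩
    rintro x (rfl | hx)
    exacts [h, hN x hx]

/-- The subspace of the regular points. -/
abbrev RegularPoints (s : UnboundedScale B) : Type := {x : ScalePoint s // x.IsRegularPoint}

instance : FirstCountableTopology (RegularPoints s) := by
  refine ⟨fun x => ?_⟩
  obtain ⟨V, hV, hU⟩ := x.2.exists_basis
  have hb : (𝓝 x.1).HasBasis (fun _ : ℕ => True) V := by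
    refine ⟨fun t => ⟨fun ht => ?_, fun ⟨j, _, hj⟩ =>
      mem_of_superset ((hV j).1.mem_nhds (hV j).2) hj⟩⟩
    obtain ⟨U, hUt, hUo, hx⟩ := mem_nhds_iff.1 ht
    obtain ⟨j, hj⟩ := hU U hUo hx
    exact ⟨j, trivial, subset_closure.trans (hj.trans hUt)⟩
  have := hb.isCountablyGenerated
  rw [nhds_subtype_eq_comap]
  infer_instance

instance : T3Space (RegularPoints s) := by
  have : RegularSpace (RegularPoints s) := by
    refine .of_exists_mem_nhds_isClosed_subset fun x t ht => ?_
    rw [nhds_subtype_eq_comap, mem_comap] at ht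
    obtain ⟨t', ht', hsub⟩ := ht
    obtain ⟨U, hUt, hUo, hx⟩ := mem_nhds_iff.1 ht'
    obtain ⟨V, hV, hU⟩ := x.2.exists_basis
    obtain ⟨j, hj⟩ := hU U hUo hx
    refine ⟨Subtype.val ⁻¹' closure (V j), ?_, isClosed_closure.preimage continuous_subtype_val,
      (preimage_mono (hj.trans hUt)).trans hsub⟩
    exact mem_of_superset (((hV j).1.preimage continuous_subtype_val).mem_nhds (hV j).2)
      (preimage_mono subset_closure)
  infer_instance

/-- The isolated points `dot n k m i`, as points of the subspace. -/
def regularDot (a : ℕ × ℕ × ℕ × Bool) : RegularPoints s :=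
  ⟨dot a.1 a.2.1 a.2.2.1 a.2.2.2, trivial⟩

instance : TopologicalSpace.SeparableSpace (RegularPoints s) := by
  refine ⟨range regularDot, countable_range _, fun x => mem_closure_iff.2 ?_⟩
  rintro _ ⟨U, hU, rfl⟩ hx
  suffices ∃ n k m i, dot n k m i ∈ U by
    obtain ⟨n, k, m, i, h⟩ := this
    exact ⟨regularDot (n, k, m, i), h, mem_range_self _⟩
  have hcol : ∀ N k, col N k ∈ U → ∃ n k m i, dot n k m i ∈ U := fun N k h => by
    obtain ⟨m, hm⟩ := (hU.1 N k h).exists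
    exact ⟨N, k, m, false, hm N false (by simp)⟩
  obtain ⟨x, hxr⟩ := x
  rcases x with ⟨n, k, m, i⟩ | ⟨N, k⟩ | ⟨n, α⟩ | N | _
  · exact ⟨n, k, m, i, hx⟩
  · exact hcol N k hx
  · obtain ⟨γ, hγ⟩ := hxr
    obtain ⟨δ, hδ, -, h⟩ := hU.2.1 n α (bot_le.trans_lt hγ.1) hx
    obtain ⟨k, h1, h2⟩ := (h.and (s.eventually_lt hδ)).exists
    exact ⟨n, k, s.fn δ k, false, h1 _ _ le_rfl h2⟩
  · exact hxr.elim
  · obtain ⟨N, hN⟩ := hU.2.2.2 hx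
    exact ⟨N, 0, 0, false, hN _ (by simp [level])⟩

theorem isScatteredSpace_regularPoints : IsScatteredSpace (RegularPoints s) := by
  intro S ⟨x₀, hx₀⟩
  have key : ∀ x : RegularPoints s, x ∈ S → ∀ U : Set (ScalePoint s), IsOpen U → x.1 ∈ U →
      (∀ y ∈ S, y.1 ∈ U → y = x) →
      ∃ x ∈ S, ∃ U : Set (RegularPoints s), IsOpen U ∧ U ∩ S = {x} := fun x hx U hU hxU h =>
    ⟨x, hx, Subtype.val ⁻¹' U, hU.preimage continuous_subtype_val,
      Subset.antisymm (fun y hy => h y hy.2 hy.1) (singleton_subset_iff.2 ⟨hxU, hx⟩)⟩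
  by_cases hd : ∃ x ∈ S, ∃ n k m i, x.1 = dot n k m i
  · obtain ⟨x, hx, n, k, m, i, h⟩ := hd
    exact key x hx {dot n k m i} (isClopen_dot n k m i).2 h fun y _ hy =>
      Subtype.ext ((show y.1 = _ from hy).trans h.symm)
  push Not at hd
  by_cases hc : ∃ x ∈ S, ∃ N k, x.1 = col N k
  · obtain ⟨x, hx, N, k, h⟩ := hc
    refine key x hx (column N k 0) (isClopen_column N k 0).2 (Or.inl h) fun y hy hyU => ?_
    rcases hyU with hyU | ⟨_, _, _, _, _, hyU⟩
    · exact Subtype.ext (hyU.trans h.symm)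
    · exact absurd hyU (hd y hy _ _ _ _)
  push Not at hc
  by_cases hr : ∃ x ∈ S, ∃ n α, x.1 = rung n α
  · obtain ⟨x, hx, n, α, h⟩ := hr
    obtain ⟨γ, hγ⟩ : ∃ γ, γ ⋖ α := by
      have := x.2
      rwa [h] at this
    refine key x hx (region n γ α 0) (isClopen_region n γ α 0).2
      (h ▸ rung_mem_region.2 ⟨rfl, hγ.1, le_rfl⟩) fun y hy hyU => ?_
    rcases hyU with ⟨β, h1, h2, hyU⟩ | ⟨_, _, _, _, _, _, hyU⟩
    · rw [h2.eq_or_lt.resolve_right (hγ.2 h1)] at hyU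
      exact Subtype.ext (hyU.trans h.symm)
    · exact absurd hyU (hd y hy _ _ _ _)
  push Not at hr
  have htop : ∀ y ∈ S, y.1 = top := by
    rintro ⟨y, hyr⟩ hy
    rcases y with ⟨n, k, m, i⟩ | ⟨N, k⟩ | ⟨n, α⟩ | N | _
    · exact absurd rfl (hd _ hy _ _ _ _)
    · exact absurd rfl (hc _ hy _ _)
    · exact absurd rfl (hr _ hy _ _)
    · exact hyr.elim
    · rfl
  exact key x₀ hx₀ univ isOpen_univ trivial fun y hy _ =>
    Subtype.ext ((htop y hy).trans (htop x₀ hx₀).symm)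

/-! ### Urysohn countably compact spaces -/

/-- The points `col N k`, as points of the subspace. -/
def regularCol (N k : ℕ) : RegularPoints s := ⟨col N k, trivial⟩

section Embedding

variable {C : Type*} [TopologicalSpace C] {e : RegularPoints s → C}

/-- A neighbourhood of a cluster point of the columns of a level contains, above some function of
the scale, infinitely many of the dots next to these columns. -/
theorem exists_frequently_dot_mem (he : Continuous e) {N n : ℕ} {i : Bool}
    (hN : n + i.toNat = N) {c : C} (hc : MapClusterPt c atTop fun k => e (regularCol N k))
    {W : Set C} (hW : IsOpen W) (hcW : c ∈ W) :
    ∃ α, ∀ β, α ≤ β → ∃ᶠ k in atTop, e (regularDot (n, k, s.fn β k, i)) ∈ W := by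
  obtain ⟨U, hU, hUW⟩ := hW.preimage he
  have hmem : ∀ x : RegularPoints s, x.1 ∈ U ↔ e x ∈ W := fun x => by
    rw [← mem_preimage (f := e), ← hUW]
    rfl
  have hfreq := hc.frequently (hW.mem_nhds hcW)
  -- `g k` is a height from which the column lies in `W`. Unboundedness is applied on the infinite
  -- set of `k` whose column limit is in `W`.
  have hg : ∀ k, ∃ g, e (regularCol N k) ∈ W → ∀ m, g ≤ m → dot n k m i ∈ U := fun k => by
    by_cases hk : e (regularCol N k) ∈ W
    · obtain ⟨g, hg⟩ := eventually_atTop.1 (hU.1 N k ((hmem _).2 hk))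
      exact ⟨g, fun _ m hm => hg m hm n i hN⟩
    · exact ⟨0, fun h => absurd h hk⟩
  choose g hg using hg
  obtain ⟨α, hα⟩ := s.unbounded _ (Nat.frequently_atTop_iff_infinite.1 hfreq) g
  refine ⟨α, fun β hβ => (hα.and_eventually (s.eventually_le hβ)).mono ?_⟩
  rintro k ⟨⟨h1, h2⟩, h3⟩
  exact (hmem _).1 (hg k h1 _ (h2.le.trans h3))

/-- Since `β` covers `γ`, the graph of `γ` eventually lies in every region that defines a
neighbourhood of `rung n β`. -/
theorem rung_mem_closure (he : Continuous e) {n : ℕ} {i : Bool} {γ β : B} (hγ : γ ⋖ β) {W : Set C}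
    (h : ∃ᶠ k in atTop, e (regularDot (n, k, s.fn γ k, i)) ∈ W) :
    e ⟨rung n β, γ, hγ⟩ ∈ closure W := by
  refine mem_closure_iff.2 fun O hO hmem => ?_
  obtain ⟨U, hU, hUO⟩ := hO.preimage he
  have hm : ∀ x : RegularPoints s, x.1 ∈ U ↔ e x ∈ O := fun x => by
    rw [← mem_preimage (f := e), ← hUO]
    rfl
  obtain ⟨δ, hδ, -, h2⟩ := hU.2.1 n β (bot_le.trans_lt hγ.1) ((hm _).2 hmem)
  have hδγ : δ ≤ γ := not_lt.1 fun h => hγ.2 h hδ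
  obtain ⟨k, h3, h4, h5, h6⟩ := (h.and_eventually (h2.and
    ((s.eventually_le hδγ).and (s.eventually_lt hγ.1)))).exists
  exact ⟨_, (hm (regularDot (n, k, s.fn γ k, i))).1 (h4 _ i h5 h6), h3⟩

theorem clusterPt_col_eq_succ [WellFoundedLT B] [T25Space C] (he : Continuous e) {N : ℕ} {c d : C}
    (hc : MapClusterPt c atTop fun k => e (regularCol N k))
    (hd : MapClusterPt d atTop fun k => e (regularCol (N + 1) k)) : c = d := by
  by_contra hne
  obtain ⟨V, hcV, hV, W, hdW, hW, hdis⟩ := exists_open_nhds_disjoint_closure hne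
  obtain ⟨α, hα⟩ := exists_frequently_dot_mem (i := false) (n := N) he rfl hc hV hcV
  obtain ⟨α', hα'⟩ := exists_frequently_dot_mem (i := true) (n := N) he rfl hd hW hdW
  -- Both copies of the graph of `max α α'` accumulate at the one point `rung N β`, which therefore
  -- lies in both closures.
  obtain ⟨β, hβ⟩ := s.exists_covBy (max α α')
  exact disjoint_left.1 hdis (rung_mem_closure he hβ (hα _ (le_max_left _ _)))
    (rung_mem_closure he hβ (hα' _ (le_max_right _ _)))

theorem not_isEmbedding [WellFoundedLT B] [T25Space C] [CountablyCompactSpace C] :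
    ¬ IsEmbedding e := by
  intro he
  have hex : ∀ N, ∃ c, MapClusterPt c atTop fun k => e (regularCol N k) := fun N =>
    let ⟨c, _, hc⟩ := CountablyCompactSpace.isCountablyCompact_univ.seq_clusterPt
      (fun k => e (regularCol N k)) (by simp)
    ⟨c, hc⟩
  choose c hc using hex
  have hc0 : ∀ N, c N = c 0 := fun N => by
    induction N with
    | zero => rfl
    | succ N ih => rw [← ih, clusterPt_col_eq_succ he.continuous (hc N) (hc (N + 1))]
  have htop : e ⟨top, trivial⟩ = c 0 := by
    by_contra hne
    obtain ⟨V, hV, W, hW, hdis⟩ := exists_nhds_disjoint_closure hne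
    have hV' := he.continuous.continuousAt.preimage_mem_nhds hV
    obtain ⟨t, ht, hsub⟩ := (mem_nhds_subtype _ _ _).1 hV'
    obtain ⟨U, hUt, hUo, hx⟩ := mem_nhds_iff.1 ht
    obtain ⟨N, hN⟩ := hUo.2.2.2 hx
    obtain ⟨k, hk⟩ := ((hc N).frequently (hc0 N ▸ hW)).exists
    exact disjoint_left.1 hdis
      (subset_closure (hsub (show (regularCol N k).1 ∈ t from hUt (hN _ le_rfl))))
      (subset_closure hk)
  -- `upper 1` contains `top` but no column limit of level `0`; only here is inducing used, beyond
  -- continuity.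
  obtain ⟨O, hO, hOU⟩ := he.isInducing.isOpen_iff.1
    ((isOpen_upper (s := s) 1).preimage continuous_subtype_val)
  have hmem : e ⟨top, trivial⟩ ∈ O := by
    rw [← mem_preimage, hOU]
    exact Or.inl rfl
  rw [htop] at hmem
  obtain ⟨k, hk⟩ := ((hc 0).frequently (hO.mem_nhds hmem)).exists
  have hk : regularCol 0 k ∈ e ⁻¹' O := hk
  rw [hOU] at hk
  simp [regularCol, upper, level] at hk

end Embedding

end ScalePoint

theorem mainTheorem1 :
    ∃ (X : Type) (_ : TopologicalSpace X),
      T3Space X ∧ TopologicalSpace.SeparableSpace X ∧ FirstCountableTopology X ∧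
      IsScatteredSpace X ∧
      (∃ (K : Type) (_ : TopologicalSpace K),
        T2Space K ∧ IsTotallyCountablyCompactSpace K ∧
        ∃ f : X → K, Topology.IsEmbedding f) ∧
      (∀ (C : Type*) [TopologicalSpace C], T25Space C → CountablyCompactSpace C →
        ¬ ∃ f : X → C, Topology.IsEmbedding f) := by
  obtain ⟨B, _, _, _, ⟨s⟩⟩ := UnboundedScale.exists_scale
  exact ⟨ScalePoint.RegularPoints s, inferInstance, inferInstance, inferInstance, inferInstance,
    ScalePoint.isScatteredSpace_regularPoints,
    ⟨ScalePoint s, inferInstance, inferInstance, ScalePoint.isTotallyCountablyCompactSpace,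
      Subtype.val, IsEmbedding.subtypeVal⟩,
    fun _ _ _ _ ⟨_, he⟩ => ScalePoint.not_isEmbedding he⟩
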